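/- Let $\Gamma$ be a nontrivial additive subgroup of $\mathbb{C}$, and let $\mathbb{C}[\Gamma\times\mathbb{Z}_{+}]$ be the semigroup algebra with basis $\{x^{\alpha,i}=x^{\alpha}t^{i} \mid \alpha\in\Gamma,\ i\in\mathbb{Z}_{+}\}$, where $\mathbb{Z}_+=\{0,1,2,\dots\}$ and $x^{\alpha,i}x^{\beta,j}=x^{\alpha+\beta,i+j}$. Let $\partial=\partial_x+t^2\partial_t$, where $\partial_x,\partial_t$ are the derivations with $\partial_x(x^{\alpha,i})=\alpha x^{\alpha,i}$ and $\partial_t(x^{\alpha,i})=i\,x^{\alpha,i-1}$. Let $W(\Gamma)=\mathbb{C}[\Gamma\times\mathbb{Z}_{+}]\,\partial$ be the complex Lie algebra of derivations (under the commutator bracket) with basis $L_{\alpha,i}=x^{\alpha,i}\partial$; thus $$[L_{\alpha,i},L_{\beta,j}]=(\beta-\alpha)L_{\alpha+\beta,i+j}+(j-i)L_{\alpha+\beta,i+j+1}\qquad(\alpha,\beta\in\Gamma,\ i,j\in\mathbb{Z}_+).$$ Let $\chi(\Gamma)$ be the group, under pointwise multiplication, of all group homomorphisms $\tau:\Gamma\to\mathbb{C}^{*}$,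 and let $\Gamma^{\mathbb{C}^{*}}=\{c\in\mathbb{C}^{*}\mid c\Gamma=\Gamma\}$. Equip the set $\chi(\Gamma)\times\Gamma^{\mathbb{C}^{*}}$ with the group structure $$(\tau_1,c_1)\cdot(\tau_2,c_2)=(\tau,c_1c_2),\qquad \tau(\alpha)=\tau_1(c_2\alpha)\,\tau_2(\alpha)\quad(\alpha\in\Gamma).$$ Theorem 4.1. There is a group isomorphism $\phi:(\tau,c)\mapsto\phi_{\tau,c}$ from $\chi(\Gamma)\times\Gamma^{\mathbb{C}^{*}}$ with this group structure onto the group $\operatorname{Aut}W(\Gamma)$ of Lie algebra automorphisms of $W(\Gamma)$ (under composition) such that $$\phi_{\tau,c}(L_{\alpha,i})=\tau(\alpha)\,c^{-i-1}L_{c\alpha,i}\qquad\text{for all }\alpha\in\Gamma,\ i\in\mathbb{Z}_{+}.$$ Moreover, $\operatorname{Aut}W(\Gamma)$ is isomorphic, as a group, to the semidirect product $\chi(\Gamma)\rtimes\Gamma^{\mathbb{C}^{*}}$ for the action $(c\tau)(\alpha)=\tau(c\alpha)$ of $\Gamma^{\mathbb{C}^{*}}$ on $\chi(\Gamma)$.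 -/

import Mathlib

open scoped Pointwise

noncomputable section

namespace NotFinGraded

/-! ### The Lie algebra `W(Γ)` -/

/-- The semigroup algebra `ℂ[Γ × ℤ₊]`. -/
abbrev A (Γ : AddSubgroup ℂ) : Type := AddMonoidAlgebra ℂ (Γ × ℕ)

/-- The standard basis of `ℂ[Γ × ℤ₊]`. -/
def monoBasis (Γ : AddSubgroup ℂ) : Module.Basis (Γ × ℕ) ℂ (A Γ) :=
  AddMonoidAlgebra.basis (Γ × ℕ) ℂ

/-- The basis monomial `x^{α,i} = x^α t^i` of `ℂ[Γ × ℤ₊]`. -/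
def mono (Γ : AddSubgroup ℂ) (α : Γ) (i : ℕ) : A Γ := AddMonoidAlgebra.single (α, i) 1

theorem monoBasis_apply (Γ : AddSubgroup ℂ) (p : Γ × ℕ) :
    monoBasis Γ p = mono Γ p.1 p.2 := by
  simp [monoBasis, mono, AddMonoidAlgebra.basis_apply]

theorem mono_mul_mono (Γ : AddSubgroup ℂ) (α β : Γ) (i j : ℕ) :
    mono Γ α i * mono Γ β j = mono Γ (α + β) (i + j) := by
  simp [mono, AddMonoidAlgebra.single_mul_single]

/-- A linear map satisfying the Leibniz rule on monomials is a derivation of `ℂ[Γ × ℤ₊]`. -/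
def derivOfMono (Γ : AddSubgroup ℂ) (D : A Γ →ₗ[ℂ] A Γ)
    (h : ∀ (α β : Γ) (i j : ℕ), D (mono Γ α i * mono Γ β j) =
      mono Γ α i * D (mono Γ β j) + mono Γ β j * D (mono Γ α i)) :
    Derivation ℂ (A Γ) (A Γ) :=
  Derivation.mk' D (by
    intro a b
    have key : (LinearMap.mul ℂ (A Γ)).compr₂ D =
        (LinearMap.mul ℂ (A Γ)).compl₂ D + ((LinearMap.mul ℂ (A Γ)).compl₂ D).flip := by
      refine (monoBasis Γ).ext fun p => (monoBasis Γ).ext fun q => ?_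
      simpa [monoBasis_apply] using h p.1 q.1 p.2 q.2
    simpa using LinearMap.congr_fun₂ key a b)

/-- The linear map underlying `∂_x`: it sends `x^{α,i}` to `α x^{α,i}`. -/
def linX (Γ : AddSubgroup ℂ) : A Γ →ₗ[ℂ] A Γ :=
  (monoBasis Γ).constr ℂ fun p => (p.1 : ℂ) • mono Γ p.1 p.2

/-- The linear map underlying `∂_t`: it sends `x^{α,i}` to `i x^{α,i-1}` (to `0` if `i = 0`). -/
def linT (Γ : AddSubgroup ℂ) : A Γ →ₗ[ℂ] A Γ :=
  (monoBasis Γ).constr ℂ fun p => (p.2 : ℂ) • mono Γ p.1 (p.2 - 1)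

theorem linX_mono (Γ : AddSubgroup ℂ) (α : Γ) (i : ℕ) :
    linX Γ (mono Γ α i) = (α : ℂ) • mono Γ α i := by
  have := (monoBasis Γ).constr_basis ℂ (fun p => (p.1 : ℂ) • mono Γ p.1 p.2) (α, i)
  rwa [monoBasis_apply] at this

theorem linT_mono (Γ : AddSubgroup ℂ) (α : Γ) (i : ℕ) :
    linT Γ (mono Γ α i) = (i : ℂ) • mono Γ α (i - 1) := by
  have := (monoBasis Γ).constr_basis ℂ (fun p => (p.2 : ℂ) • mono Γ p.1 (p.2 - 1)) (α, i)
  rwa [monoBasis_apply] at this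

/-- The derivation `∂_x` of `ℂ[Γ × ℤ₊]`. -/
def ptlX (Γ : AddSubgroup ℂ) : Derivation ℂ (A Γ) (A Γ) :=
  derivOfMono Γ (linX Γ) (by
    intro α β i j
    simp only [mono_mul_mono, linX_mono, mul_smul_comm, add_comm β α, add_comm j i,
      AddSubgroup.coe_add, ← add_smul]
    rw [add_comm (α : ℂ)])

/-- The derivation `∂_t` of `ℂ[Γ × ℤ₊]`. -/
def ptlT (Γ : AddSubgroup ℂ) : Derivation ℂ (A Γ) (A Γ) :=
  derivOfMono Γ (linT Γ) (by
    intro α β i j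
    simp only [mono_mul_mono, linT_mono, mul_smul_comm, add_comm β α, Nat.cast_add]
    rcases i with _ | i <;> rcases j with _ | j
    · simp
    · simp
    · simp
    · have h1 : i + 1 + (j + 1) - 1 = i + j + 1 := by omega
      have h2 : i + 1 + (j + 1 - 1) = i + j + 1 := by omega
      have h3 : j + 1 + (i + 1 - 1) = i + j + 1 := by omega
      rw [h1, h2, h3, ← add_smul, add_comm ((i + 1 : ℕ) : ℂ)])

/-- The derivation `∂ = ∂_x + t² ∂_t`. -/
def ptl (Γ : AddSubgroup ℂ) : Derivation ℂ (A Γ) (A Γ) :=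
  ptlX Γ + mono Γ 0 2 • ptlT Γ

/-- The Lie algebra `W(Γ) = ℂ[Γ × ℤ₊] ∂`, a Lie subalgebra of the Lie algebra of derivations of
`ℂ[Γ × ℤ₊]` under the commutator bracket. -/
def W (Γ : AddSubgroup ℂ) : LieSubalgebra ℂ (Derivation ℂ (A Γ) (A Γ)) where
  carrier := {D | ∃ f : A Γ, D = f • ptl Γ}
  zero_mem' := ⟨0, by simp⟩
  add_mem' := by
    rintro _ _ ⟨f, rfl⟩ ⟨g, rfl⟩
    exact ⟨f + g, by rw [add_smul]⟩
  smul_mem' := by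
    rintro c _ ⟨f, rfl⟩
    exact ⟨c • f, by rw [smul_assoc]⟩
  lie_mem' := by
    rintro _ _ ⟨f, rfl⟩ ⟨g, rfl⟩
    refine ⟨f * ptl Γ g - g * ptl Γ f, ?_⟩
    ext1 a
    simp only [Derivation.commutator_apply, Derivation.smul_apply, Derivation.leibniz, smul_eq_mul]
    ring

/-- The element `L_{α,i} = x^{α,i} ∂` of `W(Γ)`. -/
def L (Γ : AddSubgroup ℂ) (α : Γ) (i : ℕ) : W Γ := ⟨mono Γ α i • ptl Γ, mono Γ α i, rfl⟩

theorem ptl_mono (Γ : AddSubgroup ℂ) (α : Γ) (i : ℕ) :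
    ptl Γ (mono Γ α i) = (α : ℂ) • mono Γ α i + (i : ℂ) • mono Γ α (i + 1) := by
  have hX : ptlX Γ (mono Γ α i) = linX Γ (mono Γ α i) := rfl
  have hT : ptlT Γ (mono Γ α i) = linT Γ (mono Γ α i) := rfl
  rw [ptl, Derivation.add_apply, Derivation.smul_apply, hX, hT, linX_mono, linT_mono, smul_eq_mul,
    mul_smul_comm, mono_mul_mono, zero_add]
  rcases i with _ | i
  · simp
  · rw [show 2 + (i + 1 - 1) = i + 1 + 1 by omega]

/-- The defining relation
`[L_{α,i}, L_{β,j}] = (β - α) L_{α+β,i+j} + (j - i) L_{α+β,i+j+1}`. -/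
theorem L_lie_L (Γ : AddSubgroup ℂ) (α β : Γ) (i j : ℕ) :
    ⁅L Γ α i, L Γ β j⁆ =
      ((β : ℂ) - α) • L Γ (α + β) (i + j) + ((j : ℂ) - i) • L Γ (α + β) (i + j + 1) := by
  have h : mono Γ α i * ptl Γ (mono Γ β j) - mono Γ β j * ptl Γ (mono Γ α i) =
      ((β : ℂ) - α) • mono Γ (α + β) (i + j) + ((j : ℂ) - i) • mono Γ (α + β) (i + j + 1) := by
    simp only [ptl_mono, mul_add, mul_smul_comm, mono_mul_mono, add_comm β α]
    rw [add_comm j i, show i + (j + 1) = i + j + 1 by omega,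
      show j + (i + 1) = i + j + 1 by omega]
    module
  apply Subtype.ext
  ext1 a
  have h' := congrArg (· * ptl Γ a) h
  simp only [add_mul, smul_mul_assoc] at h'
  change ⁅mono Γ α i • ptl Γ, mono Γ β j • ptl Γ⁆ a =
    ((β : ℂ) - α) • (mono Γ (α + β) (i + j) * ptl Γ a) +
      ((j : ℂ) - i) • (mono Γ (α + β) (i + j + 1) * ptl Γ a)
  rw [← h']
  simp only [Derivation.commutator_apply, Derivation.smul_apply, Derivation.leibniz, smul_eq_mul]
  ring

/-! ### The automorphism group of a Lie algebra -/

/-- The automorphisms of a Lie algebra form a group under composition, `f * g = f ∘ g`. -/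
instance lieAutGroup {M : Type*} [LieRing M] [LieAlgebra ℂ M] : Group (M ≃ₗ⁅ℂ⁆ M) where
  mul f g := g.trans f
  one := LieEquiv.refl
  inv f := f.symm
  mul_assoc _ _ _ := rfl
  one_mul _ := rfl
  mul_one _ := rfl
  inv_mul_cancel f := DFunLike.ext _ _ fun x => f.symm_apply_apply x

/-! ### Characters and scalings of `Γ` -/

/-- `χ(Γ)`: the group of characters of `Γ`, that is, of group homomorphisms `Γ → ℂ*`, under
pointwise multiplication. -/
abbrev Chi (Γ : AddSubgroup ℂ) : Type := AddChar Γ ℂˣ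

/-- `Γ^{ℂ*} = {c ∈ ℂ* | cΓ = Γ}`, a subgroup of `ℂ*`. -/
def Scal (Γ : AddSubgroup ℂ) : Subgroup ℂˣ := MulAction.stabilizer ℂˣ Γ

theorem mem_Scal_iff (Γ : AddSubgroup ℂ) (c : ℂˣ) :
    c ∈ Scal Γ ↔ (fun z : ℂ => (c : ℂ) * z) '' (Γ : Set ℂ) = (Γ : Set ℂ) := by
  rw [Scal, MulAction.mem_stabilizer_iff, ← SetLike.coe_set_eq]
  rfl

/-- Multiplication by `c ∈ Γ^{ℂ*}` as a map `Γ → Γ`. -/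
def scale (Γ : AddSubgroup ℂ) (c : Scal Γ) : Γ →+ Γ where
  toFun α := ⟨((c : ℂˣ) : ℂ) * α, by
    have h := (mem_Scal_iff Γ c).1 c.2
    rw [← SetLike.mem_coe, ← h]
    exact ⟨α, α.2, rfl⟩⟩
  map_zero' := by simp
  map_add' α β := by ext; simp [mul_add]

theorem coe_scale (Γ : AddSubgroup ℂ) (c : Scal Γ) (α : Γ) :
    (scale Γ c α : ℂ) = ((c : ℂˣ) : ℂ) * α := rfl

theorem scale_one (Γ : AddSubgroup ℂ) (α : Γ) : scale Γ 1 α = α := by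
  ext; simp [coe_scale]

theorem scale_mul (Γ : AddSubgroup ℂ) (c d : Scal Γ) (α : Γ) :
    scale Γ (c * d) α = scale Γ c (scale Γ d α) := by
  ext; simp [coe_scale, mul_assoc]

/-- The character `cτ : α ↦ τ(cα)`. -/
def pull (Γ : AddSubgroup ℂ) (c : Scal Γ) (τ : Chi Γ) : Chi Γ :=
  τ.compAddMonoidHom (scale Γ c)

theorem pull_apply (Γ : AddSubgroup ℂ) (c : Scal Γ) (τ : Chi Γ) (α : Γ) :
    pull Γ c τ α = τ (scale Γ c α) := rfl

theorem pull_one (Γ : AddSubgroup ℂ) (τ : Chi Γ) : pull Γ 1 τ = τ := by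
  ext α; rw [pull_apply, scale_one]

theorem pull_pull (Γ : AddSubgroup ℂ) (c d : Scal Γ) (τ : Chi Γ) :
    pull Γ c (pull Γ d τ) = pull Γ (c * d) τ := by
  ext α; rw [pull_apply, pull_apply, pull_apply, mul_comm, scale_mul]

theorem pull_inv (Γ : AddSubgroup ℂ) (c : Scal Γ) (τ : Chi Γ) :
    pull Γ c τ⁻¹ = (pull Γ c τ)⁻¹ := by
  ext α; simp only [pull_apply, AddChar.inv_apply, map_neg]

/-- The action of `Γ^{ℂ*}` on `χ(Γ)` by group automorphisms, `(cτ)(α) = τ(cα)`. -/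
def charAction (Γ : AddSubgroup ℂ) : Scal Γ →* MulAut (Chi Γ) where
  toFun c :=
    { toFun := pull Γ c
      invFun := pull Γ c⁻¹
      left_inv := fun τ => by rw [pull_pull, inv_mul_cancel, pull_one]
      right_inv := fun τ => by rw [pull_pull, mul_inv_cancel, pull_one]
      map_mul' := fun _ _ => rfl }
  map_one' := by ext1 τ; exact pull_one Γ τ
  map_mul' c d := by ext1 τ; exact (pull_pull Γ c d τ).symm

/-- The set `χ(Γ) × Γ^{ℂ*}` of pairs `(τ, c)`. -/
@[ext]
structure CharScal (Γ : AddSubgroup ℂ) where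
  /-- the character `τ` -/
  char : Chi Γ
  /-- the scalar `c` -/
  scal : Scal Γ

/-- The group structure on `χ(Γ) × Γ^{ℂ*}` given by `(τ₁, c₁) (τ₂, c₂) = (τ, c₁ c₂)` with
`τ(α) = τ₁(c₂ α) τ₂(α)`. -/
instance charScalGroup (Γ : AddSubgroup ℂ) : Group (CharScal Γ) where
  mul p q := ⟨pull Γ q.scal p.char * q.char, p.scal * q.scal⟩
  one := ⟨1, 1⟩
  inv p := ⟨(pull Γ p.scal⁻¹ p.char)⁻¹, p.scal⁻¹⟩
  mul_assoc p q r := by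
    refine CharScal.ext ?_ (mul_assoc _ _ _)
    change pull Γ r.scal (pull Γ q.scal p.char * q.char) * r.char =
      pull Γ (q.scal * r.scal) p.char * (pull Γ r.scal q.char * r.char)
    rw [mul_comm q.scal, ← pull_pull, ← mul_assoc]
    rfl
  one_mul p := CharScal.ext (one_mul p.char) (one_mul p.scal)
  mul_one p := by
    refine CharScal.ext ?_ (mul_one _)
    change pull Γ 1 p.char * 1 = p.char
    rw [pull_one]
    exact mul_one p.char
  inv_mul_cancel p := by
    refine CharScal.ext ?_ (inv_mul_cancel _)
    change pull Γ p.scal (pull Γ p.scal⁻¹ p.char)⁻¹ * p.char = 1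
    rw [pull_inv, pull_pull, mul_inv_cancel, pull_one]
    exact inv_mul_cancel p.char

end NotFinGraded

end

noncomputable section

namespace NotFinGraded

variable {Γ : AddSubgroup ℂ}

/-! ### The semigroup algebra: domain, units, the coefficients in `t` -/

/-! Since `Γ ≠ ⊥`, `f ↦ f ∂` identifies `W Γ` with `A Γ` under the Wronskian bracket `a ∂b - b ∂a`,
so an automorphism becomes a linear bijection `s` preserving Wronskians. The crux is
`IsWronskian.map_mul`: `s 1 * s (a * b) = s a * s b`. The defect of this identity is a symmetric
cocycle for which `∂` is self-adjoint. Comparing eigenvalues kills it on monomials.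

Hence `s 1` and every `s (x^α)` are units of `A Γ`. As `Γ` is torsion-free, `A Γ` is a domain whose
units are the `r x^γ` with `r ≠ 0`. Compatibility with `∂` then gives `s 1 = c⁻¹` and `s (x^α) =
d(α) x^{cα}` with `cΓ = Γ`, and multiplicativity makes `c d(α)` a character. Finally `∂t = t²` shows
that `g = c² s(t)` solves `∂g = g²`. By `eq_of_ptl_eq_sq` either `g = t` or `g ∈ ℂ[Γ]`, and the
latter is impossible because `s` maps `ℂ[Γ]` onto itself.

Conversely each pair `(τ, c)` defines an automorphism by checking the bracket on basis elements.
Inverting `c` turns the twisted product on pairs into the semidirect product, `Scal Γ` being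
commutative. -/

instance twoUniqueSums_addSubgroup (Γ : AddSubgroup ℂ) : TwoUniqueSums Γ :=
  TwoUniqueSums.of_injective_addHom (G := ℂ) (Γ.subtype : Γ →ₙ+ ℂ) Subtype.val_injective
    inferInstance

/-- If the supports had more than one pair of exponents, two distinct pairs would have sums attained
only once. Nothing cancels there, so both sums lie in the support of `1` and equal `0`,
contradicting uniqueness. -/
theorem exists_single_of_mul_eq_one {M : Type*} [AddMonoid M] [TwoUniqueSums M]
    {K : Type*} [Field K] {p q : AddMonoidAlgebra K M} (h : p * q = 1) :
    ∃ (m : M) (r : K), r ≠ 0 ∧ p = AddMonoidAlgebra.single m r := by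
  classical
  have hp : p.coeff.support.Nonempty := by
    rw [Finsupp.support_nonempty_iff, ne_eq, AddMonoidAlgebra.coeff_eq_zero]
    rintro rfl; simp at h
  have hq : q.coeff.support.Nonempty := by
    rw [Finsupp.support_nonempty_iff, ne_eq, AddMonoidAlgebra.coeff_eq_zero]
    rintro rfl; simp at h
  have hcard : p.coeff.support.card * q.coeff.support.card ≤ 1 := by
    by_contra! hlt
    obtain ⟨a, ha, b, hb, hab, ua, ub⟩ := TwoUniqueSums.uniqueAdd_of_one_lt_card hlt
    rw [Finset.mem_product] at ha hb
    have key : ∀ x : M × M, x.1 ∈ p.coeff.support → x.2 ∈ q.coeff.support →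
        UniqueAdd p.coeff.support q.coeff.support x.1 x.2 → x.1 + x.2 = 0 := by
      intro x h1 h2 hu
      by_contra hne
      have := AddMonoidAlgebra.coeff_mul_add_of_uniqueAdd hu
      rw [h, AddMonoidAlgebra.one_def, AddMonoidAlgebra.coeff_single,
        Finsupp.single_eq_of_ne hne] at this
      exact mul_ne_zero (Finsupp.mem_support_iff.1 h1) (Finsupp.mem_support_iff.1 h2) this.symm
    have h0 := ub ha.1 ha.2 ((key a ha.1 ha.2 ua).trans (key b hb.1 hb.2 ub).symm)
    exact hab (Prod.ext h0.1 h0.2)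
  have h1 : p.coeff.support.card = 1 := by
    have := hp.card_pos
    have := hq.card_pos
    nlinarith
  obtain ⟨m, hm⟩ := Finset.card_eq_one.1 h1
  refine ⟨m, p.coeff m, ?_, ?_⟩
  · exact Finsupp.mem_support_iff.1 (by simp [hm])
  · apply AddMonoidAlgebra.coeff_injective
    rw [AddMonoidAlgebra.coeff_single]
    exact Finsupp.eq_single_iff.2 ⟨hm.subset, rfl⟩

theorem mono_zero_zero (Γ : AddSubgroup ℂ) : mono Γ 0 0 = 1 := rfl

theorem mono_ne_zero (α : Γ) (i : ℕ) : mono Γ α i ≠ 0 := by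
  simp [mono]

theorem exists_mono_of_mul_eq_one {p q : A Γ} (h : p * q = 1) :
    ∃ (α : Γ) (r : ℂ), r ≠ 0 ∧ p = r • mono Γ α 0 := by
  obtain ⟨⟨α, i⟩, r, hr, rfl⟩ := exists_single_of_mul_eq_one h
  obtain ⟨⟨β, j⟩, r', hr', rfl⟩ := exists_single_of_mul_eq_one ((mul_comm _ _).trans h)
  rw [AddMonoidAlgebra.single_mul_single, AddMonoidAlgebra.one_def,
    AddMonoidAlgebra.single_inj] at h
  simp only [Prod.mk_add_mk, Prod.ext_iff, Prod.fst_zero, Prod.snd_zero, one_ne_zero, and_false,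
    or_false] at h
  obtain rfl : i = 0 := by omega
  exact ⟨α, r, hr, by simp [mono]⟩

theorem smul_mono_inj {α β : Γ} {i j : ℕ} {r r' : ℂ} (hr : r ≠ 0)
    (h : r • mono Γ α i = r' • mono Γ β j) : α = β ∧ i = j ∧ r = r' := by
  simp only [mono, AddMonoidAlgebra.smul_single, smul_eq_mul, mul_one,
    AddMonoidAlgebra.single_inj, Prod.ext_iff, hr, false_and, or_false] at h
  tauto

theorem mono_eq_mul (α : Γ) (i : ℕ) : mono Γ α i = mono Γ α 0 * mono Γ 0 i := by
  rw [mono_mul_mono, add_zero, zero_add]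

theorem mono_zero_pow (i : ℕ) : mono Γ 0 1 ^ i = mono Γ 0 i := by
  induction i with
  | zero => rfl
  | succ i ih => rw [pow_succ, ih, mono_mul_mono, add_zero]

/-- The algebra map `ℂ[Γ × ℤ₊] → ℂ[Γ][X]` sending `x^{α,i}` to `x^α X^i`. -/
def toPoly (Γ : AddSubgroup ℂ) : A Γ →ₐ[ℂ] Polynomial (AddMonoidAlgebra ℂ Γ) :=
  AddMonoidAlgebra.lift ℂ _ (Γ × ℕ)
    { toFun p := Polynomial.monomial p.toAdd.2 (AddMonoidAlgebra.single p.toAdd.1 1)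
      map_one' := rfl
      map_mul' p q := by
        simp [Polynomial.monomial_mul_monomial, AddMonoidAlgebra.single_mul_single] }

theorem toPoly_mono (α : Γ) (i : ℕ) :
    toPoly Γ (mono Γ α i) = Polynomial.monomial i (AddMonoidAlgebra.single α 1) := by
  simp only [toPoly, mono, AddMonoidAlgebra.lift_single, one_smul]
  rfl

/-- The inclusion `ℂ[Γ] → ℂ[Γ × ℤ₊]`. -/
def inclX (Γ : AddSubgroup ℂ) : AddMonoidAlgebra ℂ Γ →ₐ[ℂ] A Γ :=
  AddMonoidAlgebra.lift ℂ _ Γ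
    { toFun α := mono Γ α.toAdd 0
      map_one' := rfl
      map_mul' α β := by rw [mono_mul_mono, toAdd_mul] }

theorem inclX_single (α : Γ) (r : ℂ) :
    inclX Γ (AddMonoidAlgebra.single α r) = r • mono Γ α 0 := by
  simp only [inclX, AddMonoidAlgebra.lift_single]
  rfl

theorem eval₂_toPoly (a : A Γ) :
    Polynomial.eval₂ (inclX Γ : AddMonoidAlgebra ℂ Γ →+* A Γ) (mono Γ 0 1) (toPoly Γ a) = a := by
  have key : ((Polynomial.eval₂RingHom (inclX Γ : AddMonoidAlgebra ℂ Γ →+* A Γ)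
      (mono Γ 0 1)).toAddMonoidHom.comp (toPoly Γ : A Γ →+* _).toAddMonoidHom) =
      AddMonoidHom.id _ := by
    ext ⟨α, i⟩ r : 2
    have : AddMonoidAlgebra.single (α, i) r = r • mono Γ α i := by simp [mono]
    simp only [AddMonoidHom.comp_apply, AddMonoidAlgebra.singleAddHom_apply, this,
      RingHom.toAddMonoidHom_eq_coe, AddMonoidHom.coe_coe,
      RingHom.coe_coe, map_smul, toPoly_mono, Polynomial.smul_monomial,
      Polynomial.coe_eval₂RingHom, Polynomial.eval₂_monomial, AddMonoidAlgebra.smul_single,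
      inclX_single, AddMonoidHom.id_apply]
    rw [smul_mul_assoc, mono_zero_pow, ← mono_eq_mul, smul_eq_mul, mul_one]
  exact DFunLike.congr_fun key a

/-- The derivation `∂_x` restricted to `ℂ[Γ]`. -/
def derX (Γ : AddSubgroup ℂ) : AddMonoidAlgebra ℂ Γ →ₗ[ℂ] AddMonoidAlgebra ℂ Γ :=
  (AddMonoidAlgebra.basis Γ ℂ).constr ℂ fun α => (α : ℂ) • AddMonoidAlgebra.single α 1

theorem derX_single (α : Γ) :
    derX Γ (AddMonoidAlgebra.single α 1) = (α : ℂ) • AddMonoidAlgebra.single α 1 := by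
  have := (AddMonoidAlgebra.basis Γ ℂ).constr_basis ℂ
    (fun α : Γ => (α : ℂ) • AddMonoidAlgebra.single α (1 : ℂ)) α
  rwa [AddMonoidAlgebra.basis_apply] at this

/-- `t² ∂_t` sends `t^m` to `m t^(m+1)`. The truncated `n - 1` is harmless: at `n = 0` the second
term has coefficient `0`. -/
theorem coeff_toPoly_ptl (a : A Γ) (n : ℕ) :
    (toPoly Γ (ptl Γ a)).coeff n =
      derX Γ ((toPoly Γ a).coeff n) + ((n - 1 : ℕ) : ℂ) • (toPoly Γ a).coeff (n - 1) := by
  let c (n : ℕ) : A Γ →ₗ[ℂ] AddMonoidAlgebra ℂ Γ :=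
    ((Polynomial.lcoeff (AddMonoidAlgebra ℂ Γ) n).restrictScalars ℂ).comp (toPoly Γ).toLinearMap
  have key : (c n).comp (ptl Γ).toLinearMap =
      (derX Γ).comp (c n) + ((n - 1 : ℕ) : ℂ) • c (n - 1) := by
    refine (monoBasis Γ).ext fun p => ?_
    simp only [c, monoBasis_apply, LinearMap.comp_apply, LinearMap.add_apply, LinearMap.smul_apply,
      Derivation.coeFn_coe, AlgHom.toLinearMap_apply, ptl_mono,
      map_add, map_smul, toPoly_mono, LinearMap.restrictScalars_apply, Polynomial.lcoeff_apply,
      Polynomial.coeff_monomial]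
    congr 1
    · split_ifs
      · rw [derX_single]
      · simp
    · rcases n with _ | n
      · simp
      · by_cases h : p.2 = n
        · simp [h]
        · simp [h]
  exact LinearMap.congr_fun key a

/-- A solution of `∂ g = g²` is `t`, unless it does not involve `t`. -/
theorem eq_of_ptl_eq_sq {g : A Γ} (h : ptl Γ g = g * g) :
    g = mono Γ 0 1 ∨ ∃ p, g = inclX Γ p := by
  set G := toPoly Γ g with hG
  have hc (n : ℕ) : (G * G).coeff n =
      derX Γ (G.coeff n) + ((n - 1 : ℕ) : ℂ) • G.coeff (n - 1) := by
    rw [← coeff_toPoly_ptl, h, map_mul]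
  -- In degree `n ≥ 2` the square has degree `2n`, while `∂` raises the degree in `t` by at most
  -- one.
  have hdeg : G.natDegree ≤ 1 := by
    by_contra! hlt
    have h2 := hc (G.natDegree + G.natDegree)
    rw [Polynomial.coeff_mul_degree_add_degree,
      Polynomial.coeff_eq_zero_of_natDegree_lt (by omega),
      Polynomial.coeff_eq_zero_of_natDegree_lt (n := _ - 1) (by omega)] at h2
    simp only [map_zero, smul_zero, add_zero, mul_self_eq_zero,
      Polynomial.leadingCoeff_eq_zero] at h2
    simp [h2] at hlt
  obtain ⟨q, p, hqp⟩ := Polynomial.exists_eq_X_add_C_of_natDegree_le_one hdeg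
  have hg : g = inclX Γ q * mono Γ 0 1 + inclX Γ p := by
    rw [← eval₂_toPoly g, ← hG, hqp]
    simp
  have hsq : (Polynomial.C q * Polynomial.X + Polynomial.C p) *
      (Polynomial.C q * Polynomial.X + Polynomial.C p) =
      Polynomial.C (q * q) * Polynomial.X ^ 2 + Polynomial.C (p * q + q * p) * Polynomial.X +
        Polynomial.C (p * p) := by
    simp only [map_mul, map_add]; ring
  -- For `g = q t + p`, the coefficients of `t²` and `t` give `q² = q` and `2pq = ∂_x q`. In a
  -- domain `q` is `0` or `1`, and `q = 1` forces `p = 0`.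
  have e2 : q * q = q := by
    have := hc 2
    rw [hqp, hsq] at this
    simpa [-map_mul, -map_add, Polynomial.coeff_C, Polynomial.coeff_X, Polynomial.coeff_X_pow] using this
  have e1 : p * q + q * p = derX Γ q := by
    have := hc 1
    rw [hqp, hsq] at this
    simpa [-map_mul, -map_add, Polynomial.coeff_C, Polynomial.coeff_X, Polynomial.coeff_X_pow] using this
  rcases eq_or_ne q 0 with rfl | hq
  · exact Or.inr ⟨p, by simpa using hg⟩
  · obtain rfl : q = 1 := mul_left_cancel₀ hq (by rw [e2, mul_one])
    left
    have d1 : derX Γ 1 = 0 := by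
      rw [AddMonoidAlgebra.one_def, derX_single]; simp
    rw [d1, one_mul, mul_one, ← two_smul ℂ] at e1
    have : p = 0 := by simpa using e1
    simpa [this] using hg

/-! ### Linear maps compatible with the Wronskian bracket are multiplicative up to a factor -/

/-- `s` preserves the bracket `a ∂b - b ∂a` of `ℂ[Γ × ℤ₊]`. -/
def IsWronskian (s : A Γ →ₗ[ℂ] A Γ) : Prop :=
  ∀ a b, s (a * ptl Γ b - b * ptl Γ a) = s a * ptl Γ (s b) - s b * ptl Γ (s a)

/-- The failure of `s / s(1)` to be multiplicative. -/
def defect (s : A Γ →ₗ[ℂ] A Γ) (a b : A Γ) : A Γ := s 1 * s (a * b) - s a * s b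

theorem defect_add_right (s : A Γ →ₗ[ℂ] A Γ) (a b c : A Γ) :
    defect s a (b + c) = defect s a b + defect s a c := by
  simp only [defect, mul_add, map_add]; ring

theorem defect_smul_right (s : A Γ →ₗ[ℂ] A Γ) (r : ℂ) (a b : A Γ) :
    defect s a (r • b) = r • defect s a b := by
  simp only [defect, mul_smul_comm, map_smul, smul_sub]

theorem defect_comm (s : A Γ →ₗ[ℂ] A Γ) (a b : A Γ) : defect s a b = defect s b a := by
  simp only [defect, mul_comm a b, mul_comm (s a)]

theorem defect_add_left (s : A Γ →ₗ[ℂ] A Γ) (a b c : A Γ) :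
    defect s (a + b) c = defect s a c + defect s b c := by
  simp only [defect_comm s _ c, defect_add_right]

theorem defect_smul_left (s : A Γ →ₗ[ℂ] A Γ) (r : ℂ) (a b : A Γ) :
    defect s (r • a) b = r • defect s a b := by
  simp only [defect_comm s _ b, defect_smul_right]

theorem defect_one_left (s : A Γ →ₗ[ℂ] A Γ) (a : A Γ) : defect s 1 a = 0 := by
  simp [defect]

theorem defect_cocycle (s : A Γ →ₗ[ℂ] A Γ) (a b c : A Γ) :
    s 1 * defect s (a * b) c + defect s a b * s c =
      s 1 * defect s a (b * c) + s a * defect s b c := by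
  simp only [defect, mul_assoc a b c]; ring

namespace IsWronskian

variable {s : A Γ →ₗ[ℂ] A Γ}

theorem map_ptl (hs : IsWronskian s) (a : A Γ) :
    s (ptl Γ a) = s 1 * ptl Γ (s a) - s a * ptl Γ (s 1) := by
  simpa using hs 1 a

/-- Multiply the Wronskian identity by `s 1` and eliminate `s 1 * ∂(s a)` and `s 1 * ∂(s b)` through
`map_ptl`; the terms in `∂(s 1)` cancel by symmetry. -/
theorem defect_ptl (hs : IsWronskian s) (a b : A Γ) :
    defect s a (ptl Γ b) = defect s (ptl Γ a) b := by
  have h1 := hs a b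
  rw [map_sub, mul_comm b] at h1
  simp only [defect]
  have ha := hs.map_ptl a
  have hb := hs.map_ptl b
  linear_combination s 1 * h1 - s a * hb + s b * ha

/-- With `f = s 1`, `map_ptl` says that `s` intertwines `∂` with `f ∂ - ∂f`. The defect is quadratic
in `s`, so `f ∂ - 2 ∂f` acts on it. -/
theorem ptl_defect (hs : IsWronskian s) (a b : A Γ) :
    s 1 * ptl Γ (defect s a b) - 2 * ptl Γ (s 1) * defect s a b =
      defect s (ptl Γ a) b + defect s a (ptl Γ b) := by
  have ha := hs.map_ptl a
  have hb := hs.map_ptl b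
  have hab := hs.map_ptl (a * b)
  simp only [Derivation.leibniz, smul_eq_mul, map_add] at hab
  simp only [defect, map_sub, Derivation.leibniz, smul_eq_mul]
  rw [mul_comm b] at hab
  linear_combination -s 1 * hab + s b * ha + s a * hb

theorem ptl_defect' (hs : IsWronskian s) (a b : A Γ) :
    s 1 * ptl Γ (defect s a b) - 2 * ptl Γ (s 1) * defect s a b =
      (2 : ℂ) • defect s (ptl Γ a) b := by
  rw [hs.ptl_defect, hs.defect_ptl, two_smul]

theorem defect_mono (hs : IsWronskian s) (α β : Γ) (i j : ℕ) :
    ((β : ℂ) - α) • defect s (mono Γ α i) (mono Γ β j) +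
      (j : ℂ) • defect s (mono Γ α i) (mono Γ β (j + 1)) =
      (i : ℂ) • defect s (mono Γ α (i + 1)) (mono Γ β j) := by
  have h := hs.defect_ptl (mono Γ α i) (mono Γ β j)
  simp only [ptl_mono, defect_add_left, defect_add_right, defect_smul_left,
    defect_smul_right] at h
  linear_combination (norm := module) h

theorem defect_mono_zero_of_ne (hs : IsWronskian s) {α β : Γ} (h : α ≠ β) :
    defect s (mono Γ α 0) (mono Γ β 0) = 0 := by
  have := hs.defect_mono α β 0 0
  simp only [Nat.cast_zero, zero_smul, add_zero, smul_eq_zero, sub_eq_zero] at this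
  exact this.resolve_left fun e => h (Subtype.ext e.symm)

theorem map_ne_zero (hinj : Function.Injective s) (α : Γ) (i : ℕ) : s (mono Γ α i) ≠ 0 :=
  (map_ne_zero_iff s hinj).2 (mono_ne_zero α i)

theorem map_one_ne_zero (hinj : Function.Injective s) : s 1 ≠ 0 :=
  (map_ne_zero_iff s hinj).2 one_ne_zero

theorem defect_mono_zero (hs : IsWronskian s) (hinj : Function.Injective s) (α β : Γ) :
    defect s (mono Γ α 0) (mono Γ β 0) = 0 := by
  rcases ne_or_eq α β with h | rfl
  · exact hs.defect_mono_zero_of_ne h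
  rcases eq_or_ne α 0 with rfl | hα
  · exact defect_one_left s _
  have hα' : (α : ℂ) ≠ 0 := by simpa using hα
  have ne (m n : ℕ) (h : m ≠ n) : m • α ≠ n • α := fun e => by
    have e' := congrArg (Subtype.val : Γ → ℂ) e
    simp only [AddSubgroup.coe_nsmul, nsmul_eq_mul] at e'
    exact h (Nat.cast_injective (mul_right_cancel₀ hα' e'))
  -- With third exponent `3α`, the other three defects pair distinct exponents (`2α, 3α`; `α, 4α`;
  -- `α, 3α`) and vanish, leaving `defect(x^α, x^α) * s(x^{3α}) = 0`.
  have h := defect_cocycle s (mono Γ (1 • α) 0) (mono Γ (1 • α) 0) (mono Γ (3 • α) 0)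
  simp only [mono_mul_mono, ← add_nsmul] at h
  rw [hs.defect_mono_zero_of_ne (ne (1 + 1) 3 (by norm_num)),
    hs.defect_mono_zero_of_ne (ne 1 (1 + 3) (by norm_num)),
    hs.defect_mono_zero_of_ne (ne 1 3 (by norm_num))] at h
  simpa [map_ne_zero hinj] using h

/-- The cocycle identity for `x^α, x^α, t` reads `f b₂ = f u + x b`, where `f = s 1`. The three
terms satisfy the eigenvector equation for `f ∂ - 3 ∂f` with the distinct eigenvalues `4α, 2α, 3α`,
so each vanishes. -/
theorem defect_mono_t (hs : IsWronskian s) (hinj : Function.Injective s) (α : Γ) :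
    defect s (mono Γ α 0) (mono Γ 0 1) = 0 := by
  rcases eq_or_ne α 0 with rfl | hα
  · exact defect_one_left s _
  have hα' : (α : ℂ) ≠ 0 := by simpa using hα
  have D (γ δ : Γ) (i : ℕ) : s 1 * ptl Γ (defect s (mono Γ γ 0) (mono Γ δ i)) -
      2 * ptl Γ (s 1) * defect s (mono Γ γ 0) (mono Γ δ i) =
      2 * algebraMap ℂ (A Γ) γ * defect s (mono Γ γ 0) (mono Γ δ i) := by
    rw [hs.ptl_defect', ptl_mono, Nat.cast_zero, zero_smul, add_zero, defect_smul_left,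
      Algebra.smul_def, Algebra.smul_def, map_ofNat, mul_assoc]
  have S : algebraMap ℂ (A Γ) α * s (mono Γ α 0) =
      s 1 * ptl Γ (s (mono Γ α 0)) - s (mono Γ α 0) * ptl Γ (s 1) := by
    rw [← hs.map_ptl, ptl_mono, Nat.cast_zero, zero_smul, add_zero, map_smul, Algebra.smul_def]
  have C := defect_cocycle s (mono Γ α 0) (mono Γ α 0) (mono Γ 0 1)
  simp only [mono_mul_mono, hs.defect_mono_zero hinj, zero_mul, add_zero, zero_add] at C
  have D₁ := D (α + α) 0 1
  have D₂ := D α 0 1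
  have D₃ := D α α 1
  have hx := map_ne_zero hinj α 0
  have hκ : algebraMap ℂ (A Γ) α ≠ 0 :=
    (map_ne_zero_iff _ (algebraMap ℂ (A Γ)).injective).2 hα'
  simp only [AddSubgroup.coe_add, map_add] at D₁
  generalize defect s (mono Γ (α + α) 0) (mono Γ 0 1) = b₂ at *
  generalize defect s (mono Γ α 0) (mono Γ 0 1) = b at *
  generalize defect s (mono Γ α 0) (mono Γ α 1) = u at *
  generalize s (mono Γ α 0) = x at *
  generalize algebraMap ℂ (A Γ) α = κ at *
  have C' := congrArg (ptl Γ) C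
  simp only [map_add, Derivation.leibniz, smul_eq_mul] at C'
  -- Applying `f ∂ - 3 ∂f - 2κ` to `C` eliminates `u`.
  have E : s 1 * b₂ + s 1 * b₂ = x * b := by
    apply mul_left_cancel₀ hκ
    linear_combination s 1 * C' - s 1 * D₁ + s 1 * D₃ + x * D₂ - b * S - 3 * ptl Γ (s 1) * C
      - 2 * κ * C
  have E' := congrArg (ptl Γ) E
  simp only [map_add, Derivation.leibniz, smul_eq_mul] at E'
  -- Applying `f ∂ - 3 ∂f - 4κ` to `E` eliminates `b₂`.
  have F : κ * (x * b) = 0 := by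
    linear_combination s 1 * E' - 2 * s 1 * D₁ + x * D₂ - b * S - 3 * ptl Γ (s 1) * E - 4 * κ * E
  simpa [hκ, hx] using F

theorem defect_mono_left (hs : IsWronskian s) (hinj : Function.Injective s) (α β : Γ) (j : ℕ) :
    defect s (mono Γ α 0) (mono Γ β j) = 0 := by
  have h1 : defect s (mono Γ α 0) (mono Γ β 1) = 0 := by
    have C := defect_cocycle s (mono Γ α 0) (mono Γ β 0) (mono Γ 0 1)
    simpa [mono_mul_mono, hs.defect_mono_zero hinj, hs.defect_mono_t hinj,
      map_one_ne_zero hinj] using C.symm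
  rcases j with _ | j
  · exact hs.defect_mono_zero hinj α β
  induction j with
  | zero => exact h1
  | succ j ih =>
    -- The recursion has leading coefficient `j + 1`; starting from exponent `0` it would be `0`,
    -- which is why `t^1` needs a separate argument.
    have h := hs.defect_mono α β 0 (j + 1)
    rw [ih, smul_zero, zero_add, Nat.cast_zero, zero_smul, smul_eq_zero] at h
    exact h.resolve_left (Nat.cast_ne_zero.2 (Nat.succ_ne_zero j))

theorem defect_mono_mono (hs : IsWronskian s) (hinj : Function.Injective s) (hΓ : Γ ≠ ⊥)
    (α β : Γ) (i j : ℕ) : defect s (mono Γ α i) (mono Γ β j) = 0 := by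
  have hf := map_one_ne_zero hinj
  have left (γ δ : Γ) (i j : ℕ) : s 1 * defect s (mono Γ γ i) (mono Γ δ j) =
      s (mono Γ γ 0) * defect s (mono Γ 0 i) (mono Γ δ j) := by
    have C := defect_cocycle s (mono Γ γ 0) (mono Γ 0 i) (mono Γ δ j)
    simpa only [mono_mul_mono, hs.defect_mono_left hinj, zero_mul, mul_zero, add_zero,
      zero_add] using C
  have right (δ : Γ) (i j : ℕ) : s 1 * defect s (mono Γ 0 i) (mono Γ δ j) =
      s (mono Γ δ 0) * defect s (mono Γ 0 i) (mono Γ 0 j) := by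
    rw [defect_comm, left, defect_comm]
  -- The recursion for `(0, β)`, reduced by `right` to powers of `t`, differs from the recursion for
  -- `(0, 0)` exactly by the term `β • defect(t^i, t^j)`.
  have zero (i j : ℕ) : defect s (mono Γ 0 i) (mono Γ 0 j) = 0 := by
    obtain ⟨β, hβ0⟩ := AddSubgroup.ne_bot_iff_exists_ne_zero.1 hΓ
    have h0 := hs.defect_mono 0 0 i j
    have h1 := congrArg (s 1 * ·) (hs.defect_mono 0 β i j)
    simp only [mul_add, mul_smul_comm, right, AddSubgroup.coe_zero, sub_zero] at h1
    simp only [AddSubgroup.coe_zero, sub_zero, zero_smul, zero_add] at h0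
    simp only [← mul_smul_comm, ← mul_add] at h1
    have h2 := mul_left_cancel₀ (map_ne_zero hinj β 0) h1
    rw [h0, add_eq_right, smul_eq_zero] at h2
    exact h2.resolve_left (by simpa using hβ0)
  have h := left α β i j
  apply mul_left_cancel₀ hf
  apply mul_left_cancel₀ hf
  rw [h, mul_left_comm, right, zero]
  simp

theorem map_mul (hs : IsWronskian s) (hinj : Function.Injective s) (hΓ : Γ ≠ ⊥) (a b : A Γ) :
    s 1 * s (a * b) = s a * s b := by
  have key : ((LinearMap.mul ℂ (A Γ)).compr₂ (LinearMap.mulLeft ℂ (s 1) ∘ₗ s)) =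
      (LinearMap.mul ℂ (A Γ)).compl₁₂ s s := by
    refine (monoBasis Γ).ext fun p => (monoBasis Γ).ext fun q => ?_
    simpa [monoBasis_apply, defect, sub_eq_zero] using
      hs.defect_mono_mono hinj hΓ p.1 q.1 p.2 q.2
  simpa using LinearMap.congr_fun₂ key a b

end IsWronskian

/-! ### Classification of the Wronskian linear automorphisms -/

theorem toPoly_inclX (p : AddMonoidAlgebra ℂ Γ) : toPoly Γ (inclX Γ p) = Polynomial.C p := by
  induction p using AddMonoidAlgebra.induction_linear with
  | zero => simp
  | add p q hp hq => simp only [map_add, hp, hq]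
  | single α r =>
    rw [inclX_single, map_smul, toPoly_mono, Polynomial.smul_monomial, AddMonoidAlgebra.smul_single,
      smul_eq_mul, mul_one, Polynomial.monomial_zero_left]

theorem mono_one_ne_inclX (p : AddMonoidAlgebra ℂ Γ) : mono Γ 0 1 ≠ inclX Γ p := by
  intro h
  have h1 := congrArg (fun a => (toPoly Γ a).coeff 1) h
  simp [toPoly_inclX, toPoly_mono] at h1

theorem smul_mul_smul_mono (r r' : ℂ) (α β : Γ) (i j : ℕ) :
    (r • mono Γ α i) * (r' • mono Γ β j) = (r * r') • mono Γ (α + β) (i + j) := by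
  rw [smul_mul_smul_comm, mono_mul_mono]

theorem ptl_mono_zero (α : Γ) : ptl Γ (mono Γ α 0) = (α : ℂ) • mono Γ α 0 := by
  rw [ptl_mono, Nat.cast_zero, zero_smul, add_zero]

namespace IsWronskian

variable {s : A Γ ≃ₗ[ℂ] A Γ}

theorem exists_map_mono_zero (hs : IsWronskian (s : A Γ →ₗ[ℂ] A Γ)) (hΓ : Γ ≠ ⊥) (α : Γ) :
    ∃ (δ : Γ) (d : ℂ), d ≠ 0 ∧ s (mono Γ α 0) = d • mono Γ δ 0 := by
  have hm (a b : A Γ) : s 1 * s (a * b) = s a * s b := hs.map_mul s.injective hΓ a b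
  obtain ⟨a, ha⟩ := s.surjective 1
  -- So `s 1` is a unit, and `s(x^α) s(x^{-α}) = (s 1)²` makes `s(x^α)` a unit too.
  have hf : s 1 * s (a * a) = 1 := by rw [hm, ha, mul_one]
  have hα := hm (mono Γ α 0) (mono Γ (-α) 0)
  rw [mono_mul_mono, add_neg_cancel, add_zero, mono_zero_zero] at hα
  obtain ⟨δ, d, hd, h⟩ := exists_mono_of_mul_eq_one
    (p := s (mono Γ α 0)) (q := s (mono Γ (-α) 0) * (s (a * a) * s (a * a)))
    (by linear_combination (-s (a * a) * s (a * a)) * hα + (s 1 * s (a * a) + 1) * hf)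
  exact ⟨δ, d, hd, h⟩

theorem exists_scal (hs : IsWronskian (s : A Γ →ₗ[ℂ] A Γ)) (hΓ : Γ ≠ ⊥) :
    ∃ (c : Scal Γ) (d : Γ → ℂ), s 1 = ((c : ℂˣ) : ℂ)⁻¹ • 1 ∧
      ∀ α, d α ≠ 0 ∧ s (mono Γ α 0) = d α • mono Γ (scale Γ c α) 0 := by
  have hm (a b : A Γ) : s 1 * s (a * b) = s a * s b := hs.map_mul s.injective hΓ a b
  choose δ d hd h using hs.exists_map_mono_zero hΓ
  obtain ⟨r, hr⟩ : ∃ r, d 0 = r := ⟨_, rfl⟩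
  have hr0 : r ≠ 0 := hr ▸ hd 0
  have h0 : s 1 = r • mono Γ (δ 0) 0 := hr ▸ h 0
  have hp (α : Γ) : (α * d α : ℂ) • mono Γ (δ α) 0 =
      (r * d α * (δ α - δ 0) : ℂ) • mono Γ (δ 0 + δ α) 0 := by
    have := hs.map_ptl (mono Γ α 0)
    simp only [LinearEquiv.coe_coe] at this
    rw [ptl_mono_zero, map_smul, h, h0, Derivation.map_smul, Derivation.map_smul, ptl_mono_zero, ptl_mono_zero, smul_smul,
      smul_smul, smul_smul, smul_mul_smul_mono, smul_mul_smul_mono, add_comm (δ α), ← sub_smul]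
      at this
    rw [this]
    congr 1
    ring
  obtain ⟨β, hβ⟩ := AddSubgroup.ne_bot_iff_exists_ne_zero.1 hΓ
  -- For `β ≠ 0` both sides of `hp` are nonzero, so the exponents `δ β` and `δ 0 + δ β` agree;
  -- comparing coefficients then gives `δ α = r⁻¹ α`, hence `c = r⁻¹`.
  have δ0 : δ 0 = 0 := by
    simpa using (smul_mono_inj (mul_ne_zero (by simpa using hβ) (hd β)) (hp β)).1
  have hδ (α : Γ) : (δ α : ℂ) = r⁻¹ * α := by
    rcases eq_or_ne α 0 with rfl | hα
    · simp [δ0]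
    · have := (smul_mono_inj (mul_ne_zero (by simpa using hα) (hd α)) (hp α)).2.2
      rw [δ0, AddSubgroup.coe_zero, sub_zero] at this
      rw [eq_inv_mul_iff_mul_eq₀ hr0]
      apply mul_right_cancel₀ (hd α)
      linear_combination -this
  rw [δ0, mono_zero_zero] at h0
  have hc : Units.mk0 r⁻¹ (inv_ne_zero hr0) ∈ Scal Γ := by
    rw [mem_Scal_iff]
    refine Set.Subset.antisymm ?_ ?_
    · rintro _ ⟨α, hα, rfl⟩
      have := (δ ⟨α, hα⟩).2
      rwa [hδ] at this
    · intro β hβ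
      lift β to Γ using hβ
      obtain ⟨y, hy⟩ := s.surjective (mono Γ β 0)
      obtain ⟨z, hz⟩ := s.surjective (mono Γ (-β) 0)
      have hyz := hm y z
      rw [hy, hz, mono_mul_mono, add_neg_cancel, add_zero, mono_zero_zero, h0, smul_mul_assoc,
        one_mul] at hyz
      -- `s 1 = r` gives `s (y * z) = r⁻¹`, and `r²` rescales this to `s 1`. Thus the preimage `y`
      -- of `x^β` is itself a unit, hence a multiple of some `x^α`.
      have : y * (r ^ 2 • z) = 1 := by
        apply s.injective
        rw [mul_smul_comm, map_smul, h0, sq, mul_smul, hyz]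
      obtain ⟨α, e, he, rfl⟩ := exists_mono_of_mul_eq_one this
      rw [map_smul, h, smul_smul] at hy
      obtain ⟨rfl, -, -⟩ := smul_mono_inj (r' := 1) (mul_ne_zero he (hd α)) (by rw [hy, one_smul])
      exact ⟨α, α.2, (hδ α).symm⟩
  refine ⟨⟨_, hc⟩, d, ?_, fun α => ⟨hd α, ?_⟩⟩
  · simpa using h0
  · rw [h]
    congr 2
    exact Subtype.ext (hδ α)

theorem classify (hs : IsWronskian (s : A Γ →ₗ[ℂ] A Γ)) (hΓ : Γ ≠ ⊥) :
    ∃ (τ : Chi Γ) (c : Scal Γ), ∀ (α : Γ) (i : ℕ), s (mono Γ α i) =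
      ((τ α : ℂ) * ((c : ℂˣ) : ℂ) ^ (-(i : ℤ) - 1)) • mono Γ (scale Γ c α) i := by
  have hm (a b : A Γ) : s 1 * s (a * b) = s a * s b := hs.map_mul s.injective hΓ a b
  obtain ⟨c, d, h1, hd⟩ := hs.exists_scal hΓ
  obtain ⟨k, hk⟩ : ∃ k : ℂ, ((c : ℂˣ) : ℂ) = k := ⟨_, rfl⟩
  have hk0 : k ≠ 0 := hk ▸ (c : ℂˣ).ne_zero
  rw [hk] at h1
  have hm' (a b : A Γ) : s (a * b) = k • (s a * s b) := by
    rw [← hm, h1, smul_mul_assoc, one_mul, smul_inv_smul₀ hk0]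
  have d0 : d 0 = k⁻¹ := by
    have := (hd 0).2
    rw [map_zero, mono_zero_zero, h1, ← mono_zero_zero] at this
    exact (smul_mono_inj (inv_ne_zero hk0) this).2.2.symm
  have dadd (α β : Γ) : d (α + β) = k * (d α * d β) := by
    have := hm' (mono Γ α 0) (mono Γ β 0)
    rw [mono_mul_mono, add_zero, (hd _).2, (hd _).2, (hd _).2, smul_mul_smul_mono, smul_smul] at this
    exact (smul_mono_inj (hd _).1 this).2.2
  let τ : Chi Γ :=
    { toFun α := Units.mk0 (k * d α) (mul_ne_zero hk0 (hd α).1)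
      map_zero_eq_one' := by ext; simp [d0, hk0]
      map_add_eq_mul' α β := by ext; simp [dadd]; ring }
  have ht : s (mono Γ 0 1) = k⁻¹ ^ 2 • mono Γ 0 1 := by
    have e1 : k • ptl Γ (s (mono Γ 0 1)) = k ^ 3 • (s (mono Γ 0 1) * s (mono Γ 0 1)) := by
      have e := hs.map_ptl (mono Γ 0 1)
      simp only [LinearEquiv.coe_coe, h1, Derivation.map_smul, Derivation.map_one_eq_zero, smul_zero, mul_zero,
        sub_zero, smul_mul_assoc, one_mul] at e
      have e' := hm' (mono Γ 0 1) (mono Γ 0 1)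
      rw [ptl_mono, AddSubgroup.coe_zero, zero_smul, zero_add, Nat.cast_one, one_smul] at e
      rw [mono_mul_mono, add_zero, e, inv_smul_eq_iff₀ hk0] at e'
      rw [e', smul_smul, smul_smul]
      congr 1
      ring
    have e2 : ptl Γ (k ^ 2 • s (mono Γ 0 1)) =
        (k ^ 2 • s (mono Γ 0 1)) * (k ^ 2 • s (mono Γ 0 1)) := by
      rw [Derivation.map_smul, smul_mul_smul_comm, sq, mul_smul, e1, smul_smul]
      congr 1
      ring
    rw [inv_pow, eq_inv_smul_iff₀ (pow_ne_zero 2 hk0)]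
    refine (eq_of_ptl_eq_sq e2).resolve_right ?_
    rintro ⟨p, hp⟩
    -- Surjectivity of `s` on `ℂ[Γ]`: were `k² s(t)` in `ℂ[Γ]`, injectivity would put `t` there.
    have lift : ∀ p, ∃ p', s (inclX Γ p') = inclX Γ p := by
      intro p
      induction p using AddMonoidAlgebra.induction_linear with
      | zero => exact ⟨0, by simp⟩
      | add p q hp hq =>
        obtain ⟨p', hp'⟩ := hp
        obtain ⟨q', hq'⟩ := hq
        exact ⟨p' + q', by simp only [map_add, hp', hq']⟩
      | single β r =>
        refine ⟨AddMonoidAlgebra.single (scale Γ c⁻¹ β) (r / d (scale Γ c⁻¹ β)), ?_⟩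
        rw [inclX_single, map_smul, (hd _).2, smul_smul, div_mul_cancel₀ _ (hd _).1,
          ← scale_mul, mul_inv_cancel, scale_one, inclX_single]
    obtain ⟨p', hp'⟩ := lift p
    rw [← hp', ← map_smul, s.injective.eq_iff] at hp
    refine mono_one_ne_inclX ((k ^ 2)⁻¹ • p') ?_
    rw [map_smul, ← hp, inv_smul_smul₀ (pow_ne_zero 2 hk0)]
  refine ⟨τ, c, fun α i => ?_⟩
  rw [hk]
  have hτ : (τ α : ℂ) = k * d α := rfl
  induction i with
  | zero =>
    rw [(hd α).2, hτ]
    congr 1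
    rw [Nat.cast_zero, neg_zero, zero_sub, zpow_neg_one]
    field_simp
  | succ i ih =>
    have := hm' (mono Γ α i) (mono Γ 0 1)
    rw [mono_mul_mono, add_zero, ih, ht, smul_mul_smul_mono, add_zero, smul_smul] at this
    rw [this]
    congr 1
    rw [show -((i + 1 : ℕ) : ℤ) - 1 = (-(i : ℤ) - 1) - 1 by push_cast; ring,
      zpow_sub_one₀ hk0 (-(i : ℤ) - 1)]
    generalize k ^ (-(i : ℤ) - 1) = z
    field_simp

end IsWronskian

/-! ### Automorphisms of `W(Γ)` -/

/-- The linear isomorphism `f ↦ f ∂` from `ℂ[Γ × ℤ₊]` onto `W(Γ)`. -/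
def equivW (hΓ : Γ ≠ ⊥) : A Γ ≃ₗ[ℂ] W Γ :=
  LinearEquiv.ofBijective
    { toFun f := (⟨f • ptl Γ, f, rfl⟩ : W Γ)
      map_add' f g := Subtype.ext (add_smul f g _)
      map_smul' r f := Subtype.ext (smul_assoc r f _) }
    ⟨by
      rw [← LinearMap.ker_eq_bot, LinearMap.ker_eq_bot']
      intro f hf
      obtain ⟨β, hβ⟩ := AddSubgroup.ne_bot_iff_exists_ne_zero.1 hΓ
      -- `∂ x^β = β x^β` is nonzero for `β ≠ 0`, and `A Γ` is a domain.
      have h : f * ptl Γ (mono Γ β 0) = 0 :=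
        DFunLike.congr_fun (congrArg Subtype.val hf) (mono Γ β 0)
      rw [ptl_mono_zero, mul_smul_comm, smul_eq_zero, mul_eq_zero] at h
      simpa [hβ, mono_ne_zero] using h,
    by
      rintro ⟨_, f, rfl⟩
      exact ⟨f, rfl⟩⟩

theorem equivW_mono (hΓ : Γ ≠ ⊥) (α : Γ) (i : ℕ) : equivW hΓ (mono Γ α i) = L Γ α i := rfl

theorem equivW_lie (hΓ : Γ ≠ ⊥) (f g : A Γ) :
    ⁅equivW hΓ f, equivW hΓ g⁆ = equivW hΓ (f * ptl Γ g - g * ptl Γ f) := by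
  apply Subtype.ext
  ext1 a
  change ⁅f • ptl Γ, g • ptl Γ⁆ a = (f * ptl Γ g - g * ptl Γ f) • ptl Γ a
  simp only [Derivation.commutator_apply, Derivation.smul_apply, Derivation.leibniz, smul_eq_mul]
  ring

/-- The basis `L_{α,i}` of `W(Γ)`. -/
def basisW (hΓ : Γ ≠ ⊥) : Module.Basis (Γ × ℕ) ℂ (W Γ) := (monoBasis Γ).map (equivW hΓ)

theorem basisW_apply (hΓ : Γ ≠ ⊥) (p : Γ × ℕ) : basisW hΓ p = L Γ p.1 p.2 := by
  rw [basisW, Module.Basis.map_apply, monoBasis_apply, equivW_mono]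

theorem lieHom_ext (hΓ : Γ ≠ ⊥) {φ ψ : W Γ →ₗ⁅ℂ⁆ W Γ}
    (h : ∀ α i, φ (L Γ α i) = ψ (L Γ α i)) (x : W Γ) : φ x = ψ x := by
  have key : (φ : W Γ →ₗ[ℂ] W Γ) = ψ :=
    (basisW hΓ).ext fun p => by simpa [basisW_apply] using h p.1 p.2
  exact LinearMap.congr_fun key x

theorem smul_L_inj (hΓ : Γ ≠ ⊥) {α β : Γ} {i j : ℕ} {r r' : ℂ} (hr : r ≠ 0)
    (h : r • L Γ α i = r' • L Γ β j) : α = β ∧ i = j ∧ r = r' := by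
  rw [← equivW_mono hΓ, ← equivW_mono hΓ, ← map_smul, ← map_smul,
    (equivW hΓ).injective.eq_iff] at h
  exact smul_mono_inj hr h

/-- The factor `τ(α) c^{-i-1}`. -/
def autCoeff (p : CharScal Γ) (α : Γ) (i : ℕ) : ℂ :=
  (p.char α : ℂ) * ((p.scal : ℂˣ) : ℂ) ^ (-(i : ℤ) - 1)

theorem autCoeff_ne_zero (p : CharScal Γ) (α : Γ) (i : ℕ) : autCoeff p α i ≠ 0 :=
  mul_ne_zero (Units.ne_zero _) (zpow_ne_zero _ (Units.ne_zero _))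

theorem autCoeff_mul (p q : CharScal Γ) (α : Γ) (i : ℕ) :
    autCoeff (p * q) α i = autCoeff q α i * autCoeff p (scale Γ q.scal α) i := by
  have h1 : (p * q).char α = p.char (scale Γ q.scal α) * q.char α := rfl
  have h2 : (p * q).scal = p.scal * q.scal := rfl
  simp only [autCoeff, h1, h2, Subgroup.coe_mul, Units.val_mul, mul_zpow]
  ring

theorem autCoeff_one (α : Γ) (i : ℕ) : autCoeff (1 : CharScal Γ) α i = 1 := by
  have h1 : (1 : CharScal Γ).char α = 1 := rfl
  have h2 : (1 : CharScal Γ).scal = 1 := rfl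
  simp [autCoeff, h1, h2]

/-- The linear map underlying `φ_{τ,c}`. -/
def autLin (hΓ : Γ ≠ ⊥) (p : CharScal Γ) : W Γ →ₗ[ℂ] W Γ :=
  (basisW hΓ).constr ℂ fun q => autCoeff p q.1 q.2 • L Γ (scale Γ p.scal q.1) q.2

theorem autLin_L (hΓ : Γ ≠ ⊥) (p : CharScal Γ) (α : Γ) (i : ℕ) :
    autLin hΓ p (L Γ α i) = autCoeff p α i • L Γ (scale Γ p.scal α) i := by
  have := (basisW hΓ).constr_basis ℂ
    (fun q => autCoeff p q.1 q.2 • L Γ (scale Γ p.scal q.1) q.2) (α, i)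
  rwa [basisW_apply] at this

/-- The factors multiply to `c^{-i-j-2}`. The degree `i + j` term gains one `c` from `cβ - cα`, and
the degree `i + j + 1` term gains none, as `c^{-n-1}` requires in each degree `n`. -/
theorem autLin_lie_L (hΓ : Γ ≠ ⊥) (p : CharScal Γ) (α β : Γ) (i j : ℕ) :
    autLin hΓ p ⁅L Γ α i, L Γ β j⁆ = ⁅autLin hΓ p (L Γ α i), autLin hΓ p (L Γ β j)⁆ := by
  have hc := (p.scal : ℂˣ).ne_zero
  rw [autLin_L, autLin_L, smul_lie, lie_smul, L_lie_L, L_lie_L]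
  simp only [map_add, map_smul, autLin_L, smul_add, smul_smul, coe_scale]
  congr 2
  · simp only [autCoeff, AddChar.map_add_eq_mul, Units.val_mul]
    rw [show -((i + j : ℕ) : ℤ) - 1 = (-(i : ℤ) - 1) + (-(j : ℤ) - 1) + 1 by push_cast; ring,
      zpow_add₀ hc, zpow_add₀ hc, zpow_one]
    ring
  · simp only [autCoeff, AddChar.map_add_eq_mul, Units.val_mul]
    rw [show -((i + j + 1 : ℕ) : ℤ) - 1 = (-(i : ℤ) - 1) + (-(j : ℤ) - 1) by push_cast; ring,
      zpow_add₀ hc]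
    ring

/-- The Lie algebra endomorphism `φ_{τ,c}`. -/
def autHom (hΓ : Γ ≠ ⊥) (p : CharScal Γ) : W Γ →ₗ⁅ℂ⁆ W Γ :=
  { autLin hΓ p with
    map_lie' := by
      intro x y
      have key : (LieModule.toEnd ℂ (W Γ) (W Γ) : W Γ →ₗ[ℂ] _).compr₂ (autLin hΓ p) =
          (LieModule.toEnd ℂ (W Γ) (W Γ) : W Γ →ₗ[ℂ] _).compl₁₂ (autLin hΓ p) (autLin hΓ p) := by
        refine (basisW hΓ).ext fun q => (basisW hΓ).ext fun r => ?_
        simpa [basisW_apply] using autLin_lie_L hΓ p q.1 r.1 q.2 r.2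
      exact LinearMap.congr_fun₂ key x y }

theorem autHom_L (hΓ : Γ ≠ ⊥) (p : CharScal Γ) (α : Γ) (i : ℕ) :
    autHom hΓ p (L Γ α i) = autCoeff p α i • L Γ (scale Γ p.scal α) i :=
  autLin_L hΓ p α i

theorem autHom_mul (hΓ : Γ ≠ ⊥) (p q : CharScal Γ) (x : W Γ) :
    autHom hΓ (p * q) x = autHom hΓ p (autHom hΓ q x) := by
  refine lieHom_ext hΓ (ψ := (autHom hΓ p).comp (autHom hΓ q)) (fun α i => ?_) x
  rw [LieHom.comp_apply, autHom_L, autHom_L, map_smul, autHom_L, smul_smul, autCoeff_mul,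
    ← scale_mul]
  rfl

theorem autHom_one (hΓ : Γ ≠ ⊥) (x : W Γ) : autHom hΓ 1 x = x := by
  refine lieHom_ext hΓ (ψ := LieHom.id) (fun α i => ?_) x
  rw [autHom_L, autCoeff_one, one_smul]
  exact congrArg (L Γ · i) (scale_one Γ α)

/-- The Lie algebra automorphism `φ_{τ,c}`. -/
def autEquiv (hΓ : Γ ≠ ⊥) (p : CharScal Γ) : W Γ ≃ₗ⁅ℂ⁆ W Γ :=
  { autHom hΓ p with
    invFun := autHom hΓ p⁻¹
    left_inv := fun x =>
      (autHom_mul hΓ p⁻¹ p x).symm.trans (by rw [inv_mul_cancel, autHom_one])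
    right_inv := fun x =>
      (autHom_mul hΓ p p⁻¹ x).symm.trans (by rw [mul_inv_cancel, autHom_one]) }

theorem autEquiv_apply (hΓ : Γ ≠ ⊥) (p : CharScal Γ) (x : W Γ) :
    autEquiv hΓ p x = autHom hΓ p x := rfl

theorem lieAut_mul_apply (φ ψ : W Γ ≃ₗ⁅ℂ⁆ W Γ) (x : W Γ) : (φ * ψ) x = φ (ψ x) := rfl

/-- The homomorphism `(τ, c) ↦ φ_{τ,c}`. -/
def autMonoidHom (hΓ : Γ ≠ ⊥) : CharScal Γ →* (W Γ ≃ₗ⁅ℂ⁆ W Γ) :=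
  MonoidHom.mk' (autEquiv hΓ) fun p q => DFunLike.ext _ _ fun x => by
    rw [lieAut_mul_apply, autEquiv_apply, autEquiv_apply, autEquiv_apply, autHom_mul]

theorem autMonoidHom_L (hΓ : Γ ≠ ⊥) (p : CharScal Γ) (α : Γ) (i : ℕ) :
    autMonoidHom hΓ p (L Γ α i) = autCoeff p α i • L Γ (scale Γ p.scal α) i :=
  autLin_L hΓ p α i

theorem autMonoidHom_injective (hΓ : Γ ≠ ⊥) : Function.Injective (autMonoidHom hΓ) := by
  intro p q h
  have key (α : Γ) : autCoeff p α 0 = autCoeff q α 0 := by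
    have := DFunLike.congr_fun h (L Γ α 0)
    rw [autMonoidHom_L, autMonoidHom_L] at this
    exact (smul_L_inj hΓ (autCoeff_ne_zero _ _ _) this).2.2
  -- At `α = 0` the character is trivial and the coefficient is `c⁻¹`.
  have hc : ((p.scal : ℂˣ) : ℂ) = (q.scal : ℂˣ) := by
    simpa [autCoeff] using key 0
  refine CharScal.ext ?_ (Subtype.ext (Units.ext hc))
  ext α
  have := key α
  simp only [autCoeff, hc] at this
  exact mul_right_cancel₀ (zpow_ne_zero _ (Units.ne_zero _)) this

theorem autMonoidHom_surjective (hΓ : Γ ≠ ⊥) : Function.Surjective (autMonoidHom hΓ) := by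
  intro φ
  have hs : IsWronskian
      (((equivW hΓ).trans φ.toLinearEquiv).trans (equivW hΓ).symm : A Γ →ₗ[ℂ] A Γ) := by
    intro a b
    apply (equivW hΓ).injective
    rw [← equivW_lie]
    change equivW hΓ ((equivW hΓ).symm (φ (equivW hΓ _))) =
      ⁅equivW hΓ ((equivW hΓ).symm (φ (equivW hΓ _))),
        equivW hΓ ((equivW hΓ).symm (φ (equivW hΓ _)))⁆
    rw [LinearEquiv.apply_symm_apply, LinearEquiv.apply_symm_apply, LinearEquiv.apply_symm_apply,
      ← equivW_lie, LieEquiv.map_lie]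
  obtain ⟨τ, c, h⟩ := hs.classify hΓ
  refine ⟨⟨τ, c⟩, DFunLike.ext _ _ ?_⟩
  refine lieHom_ext hΓ (φ := (autMonoidHom hΓ ⟨τ, c⟩).toLieHom) (ψ := φ.toLieHom) fun α i => ?_
  have h' := congrArg (equivW hΓ) (h α i)
  change equivW hΓ ((equivW hΓ).symm (φ (equivW hΓ _))) = _ at h'
  rw [LinearEquiv.apply_symm_apply, map_smul, equivW_mono, equivW_mono] at h'
  exact (autMonoidHom_L hΓ _ α i).trans h'.symm

/-- The isomorphism of `χ(Γ) × Γ^{ℂ*}` with the semidirect product, inverting the scalar. -/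
def charScalEquiv (Γ : AddSubgroup ℂ) : CharScal Γ ≃* (Chi Γ ⋊[charAction Γ] Scal Γ) where
  toFun p := ⟨pull Γ p.scal⁻¹ p.char, p.scal⁻¹⟩
  invFun x := ⟨pull Γ x.right⁻¹ x.left, x.right⁻¹⟩
  left_inv p := CharScal.ext
    (by simp only [inv_inv, pull_pull, mul_inv_cancel, pull_one]) (inv_inv _)
  right_inv x := SemidirectProduct.ext
    (by simp only [inv_inv, pull_pull, mul_inv_cancel, pull_one]) (inv_inv _)
  map_mul' p q := by
    refine SemidirectProduct.ext ?_ ?_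
    · change pull Γ (p.scal * q.scal)⁻¹ (pull Γ q.scal p.char * q.char) =
        pull Γ p.scal⁻¹ p.char * pull Γ p.scal⁻¹ (pull Γ q.scal⁻¹ q.char)
      have : pull Γ (p.scal * q.scal)⁻¹ (pull Γ q.scal p.char * q.char) =
          pull Γ (p.scal * q.scal)⁻¹ (pull Γ q.scal p.char) *
            pull Γ (p.scal * q.scal)⁻¹ q.char := rfl
      rw [this, pull_pull, pull_pull, mul_inv, inv_mul_cancel_right]
    · change (p.scal * q.scal)⁻¹ = p.scal⁻¹ * q.scal⁻¹
      exact mul_inv _ _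

end NotFinGraded

end

open NotFinGraded in
theorem theorem4p1 (Γ : AddSubgroup ℂ) (hΓ : Γ ≠ ⊥) :
    (∃ φ : CharScal Γ ≃* (W Γ ≃ₗ⁅ℂ⁆ W Γ),
      ∀ (τ : Chi Γ) (c : Scal Γ) (α : Γ) (i : ℕ),
        φ ⟨τ, c⟩ (L Γ α i) =
          ((τ α : ℂ) * ((c : ℂˣ) : ℂ) ^ (-(i : ℤ) - 1)) • L Γ (scale Γ c α) i) ∧
    Nonempty ((W Γ ≃ₗ⁅ℂ⁆ W Γ) ≃* (Chi Γ ⋊[charAction Γ] Scal Γ)) := by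
  let φ : CharScal Γ ≃* (W Γ ≃ₗ⁅ℂ⁆ W Γ) := MulEquiv.ofBijective (autMonoidHom hΓ)
    ⟨autMonoidHom_injective hΓ, autMonoidHom_surjective hΓ⟩
  exact ⟨⟨φ, fun τ c => autMonoidHom_L hΓ ⟨τ, c⟩⟩, ⟨φ.symm.trans (charScalEquiv Γ)⟩⟩
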